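/- Let $\Omega_1=\Omega_2=\{0,1\}^{\mathbb N}$ be two copies of the Cantor space, and for a finite binary string $a$ let $[a]$ be the set of its infinite extensions. Let $P$ be a computable probability measure on $\Omega_1\times\Omega_2$ (the reals $P([a]\times[b])$ are computable uniformly in $a,b$), and let $P_1$ be its marginal distribution on $\Omega_1$. Randomness is meant in the sense of Martin-Löf: a point is $\mu$-random if it does not belong to $\bigcap_n U_n$ for any uniformly effectively open sequence $(U_n)$ with $\mu(U_n)\le 2^{-n}$ for all $n$. Let $\alpha_1\in\Omega_1$ be $P_1$-random. Then the conditional measure $P(\cdot\,|\,\alpha_1)$ on $\Omega_2$ is well defined: $P_1([a])>0$ for every prefix $a$ of $\alpha_1$, and there is a unique measure $P(\cdot\,|\,\alpha_1)$ on $\Omega_2$ such that for every finite binary string $b$ $$P([b]\,|\,\alpha_1)=\lim_{n\to\infty}\frac{P([a_n]\times[b])}{P_1([a_n])},$$ where $a_n$ is the prefix of $\alpha_1$ of length $n$; it is a probability measure. Moreover, the set of all $\alpha_2\in\Omega_2$ such that the pair $(\alpha_1,\alpha_2)$ is $P$-random is measurable and has probability $1$ according to $P(\cdot\,|\,\alpha_1)$.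 -/

import Mathlib

open MeasureTheory Filter Topology
open scoped ENNReal

/-- The Cantor space of infinite binary sequences, with the product topology and
the product (= Borel) sigma-algebra. -/
abbrev Cantor : Type := ℕ → Bool

/-- The initial segment of length `n` of an infinite binary sequence. -/
def initSeg (α : Cantor) (n : ℕ) : List Bool := (List.range n).map α

/-- The interval `[a]`: all infinite binary sequences that extend the string `a`. -/
def cyl (a : List Bool) : Set Cantor := {α | initSeg α a.length = a}

/-- The basic open rectangle `[a] × [b]` in the product of two Cantor spaces. -/
def rect (p : List Bool × List Bool) : Set (Cantor × Cantor) := cyl p.1 ×ˢ cyl p.2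

/-- A measure on the product of two Cantor spaces is computable if the measures of the basic
rectangles `[a] × [b]` are computable real numbers, uniformly in `a` and `b`: an algorithm, given
`a`, `b` and `n`, finds the numerator of a dyadic rational with denominator `2 ^ n` that
approximates the measure of `[a] × [b]` with error at most `2 ^ (-n)`. -/
def IsComputableMeasure (P : Measure (Cantor × Cantor)) : Prop :=
  ∃ f : (List Bool × List Bool) × ℕ → ℕ, Computable f ∧
    ∀ (p : List Bool × List Bool) (n : ℕ),
      |P.real (rect p) - (f (p, n) : ℝ) / 2 ^ n| ≤ 1 / 2 ^ n

section Randomness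

variable {ι X : Type*} [Primcodable ι]

/-- `U 0, U 1, …` is a uniformly effectively open sequence of sets, with respect to the
indexed family `B` of basic open sets: each `U n` is the union of a family of basic sets, and
this family is recursively enumerable uniformly in `n`. -/
def UniformlyEffectivelyOpen (B : ι → Set X) (U : ℕ → Set X) : Prop :=
  ∃ W : ℕ × ι → Prop, REPred W ∧ ∀ n, U n = ⋃ i ∈ {i | W (n, i)}, B i

/-- A Martin-Löf test for the measure `μ`. -/
def IsMLTest [MeasurableSpace X] (B : ι → Set X) (μ : Measure X) (U : ℕ → Set X) : Prop :=
  UniformlyEffectivelyOpen B U ∧ ∀ n, μ (U n) ≤ (2 ^ n)⁻¹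

/-- `x` is Martin-Löf random with respect to `μ`: no Martin-Löf test rejects `x`. -/
def IsMLRandom [MeasurableSpace X] (B : ι → Set X) (μ : Measure X) (x : X) : Prop :=
  ∀ U : ℕ → Set X, IsMLTest B μ U → x ∉ ⋂ n, U n

end Randomness

/-- `Q` is the conditional measure `P(· | α₁)` on the second coordinate: all the intervals `[a]`
containing `α₁` have positive measure under the marginal distribution, and for every string `b`
the conditional probability `P([a] × [b]) / P([a] × Ω₂)` tends to `Q [b]` as the length of the
prefix `a` of `α₁` tends to infinity. -/
def IsConditionalMeasure (P : Measure (Cantor × Cantor)) (α₁ : Cantor) (Q : Measure Cantor) :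
    Prop :=
  (∀ n, P.fst (cyl (initSeg α₁ n)) ≠ 0) ∧
    ∀ b : List Bool,
      Tendsto (fun n => P (rect (initSeg α₁ n, b)) / P.fst (cyl (initSeg α₁ n))) atTop
        (𝓝 (Q (cyl b)))

/-! Existence of the conditional measure is an effective Doob upcrossing argument. Fix `b` and
nonnegative rationals `q < r`. Along prefixes of a point, the ratio `P([a]×[b]) / P₁([a])` can rise
from below `q` to above `r` at least `k` times only on an open set of `P₁`-measure at most `(q/r)^k`
(`real_upcrossingSet_le`). Strict inequalities between computable reals are semidecidable, so these
sets are effectively open, and a subsequence of them is a Martin-Löf test. A random `α₁` therefore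
has finitely many upcrossings, so the ratios converge (`IsMLRandom.exists_tendsto`). Compactness of
the space of probability measures turns the limits into a measure.

For the second claim, take a test `U` for `P`. The `α₁` having a prefix above which `U (2m)` has
conditional measure more than `2^(-m)` form an effectively open set of `P₁`-measure at most `2^m ·
2^(-2m) = 2^(-m)`. These sets give a test, so a random `α₁` avoids one with `m` arbitrarily large
(`IsMLRandom.exists_not_isHeavyPrefix`). Passing to the limit along prefixes bounds the section of
`U (2m)` by `2^(-m)` (`IsConditionalMeasure.section_le`). Hence the section of `⋂ n, U n` is null.
There are only countably many tests, so no universal test is needed. -/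

/-- The list of pairs of consecutive entries of a list. -/
def consecutivePairs {β : Type*} (l : List β) : List (β × β) :=
  List.recOn l [] fun b t r => (t.head?.map (Prod.mk b)).toList ++ r

/-- `IterRel R k a`: there is an `R`-chain of `k` steps that ends in `a`. -/
def IterRel {β : Type*} (R : β → β → Prop) : ℕ → β → Prop
  | 0, _ => True
  | k + 1, a => ∃ c, IterRel R k c ∧ R c a

/-- Turns the recursion into one existential over lists followed by a bounded universal quantifier,
both of which preserve recursive enumerability. -/
theorem iterRel_iff_exists_list {β : Type*} (R : β → β → Prop) (k : ℕ) (a : β) :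
    IterRel R k a ↔
      ∃ l : List β, l.length = k ∧ ∀ e ∈ consecutivePairs (a :: l), R e.2 e.1 := by
  induction k generalizing a with
  | zero => simp [IterRel, consecutivePairs]
  | succ k ih =>
    simp only [IterRel, ih]
    constructor
    · rintro ⟨c, ⟨l, hl, h⟩, hR⟩
      refine ⟨c :: l, by simp [hl], ?_⟩
      change ∀ e ∈ (a, c) :: consecutivePairs (c :: l), R e.2 e.1
      simpa using ⟨hR, by simpa using h⟩
    · rintro ⟨_ | ⟨c, l⟩, hl, h⟩
      · simp at hl
      · change ∀ e ∈ (a, c) :: consecutivePairs (c :: l), R e.2 e.1 at h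
        exact ⟨c, ⟨l, by simpa using hl, fun e he => h e (by simp [he])⟩, h (a, c) (by simp)⟩

/-! ### Closure properties of recursively enumerable predicates -/

section RecursivelyEnumerable

variable {α β γ : Type*} [Primcodable α] [Primcodable β] [Primcodable γ]

theorem PrimrecRel.rePred_exists_nat {R : α → ℕ → Prop} (hR : PrimrecRel R) :
    REPred fun a => ∃ n, R a n := by
  classical
  have h := (Partrec.rfind (p := fun a n => Part.some (decide (R a n)))
    hR.decide.to_comp.partrec).dom_re
  refine h.of_eq fun a => ?_
  refine Nat.rfind_dom.trans ⟨?_, ?_⟩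
  · rintro ⟨n, hn, -⟩
    exact ⟨n, by simpa using hn⟩
  · rintro ⟨n, hn⟩
    exact ⟨n, by simpa using hn, fun _ => trivial⟩

/-- The stage is the fuel given to `evaln`. Monotonicity in the stage lets finitely many conditions
be brought to a common stage. -/
theorem REPred.exists_primrecRel {p : α → Prop} (hp : REPred p) :
    ∃ R : α → ℕ → Prop, PrimrecRel R ∧ (∀ a m n, m ≤ n → R a m → R a n) ∧
      ∀ a, p a ↔ ∃ n, R a n := by
  obtain ⟨c, hc⟩ := Nat.Partrec.Code.exists_code.1 hp
  refine ⟨fun a n => (Nat.Partrec.Code.evaln n c (Encodable.encode a)).isSome = true, ?_, ?_, ?_⟩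
  · refine Primrec.eq.comp (Primrec.option_isSome.comp
      (Nat.Partrec.Code.primrec_evaln.comp
        (Primrec.pair (Primrec.pair Primrec.snd (Primrec.const c))
          (Primrec.encode.comp Primrec.fst)))) (Primrec.const true)
  · intro a m n hmn h
    obtain ⟨x, hx⟩ := Option.isSome_iff_exists.1 h
    exact Option.isSome_iff_exists.2 ⟨x, Nat.Partrec.Code.evaln_mono hmn hx⟩
  · intro a
    have h1 : p a ↔ (Nat.Partrec.Code.eval c (Encodable.encode a)).Dom := by
      rw [hc]; simp [Part.assert, Part.bind, Part.map]
    rw [h1, Part.dom_iff_mem]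
    simp only [Nat.Partrec.Code.evaln_complete, Option.isSome_iff_exists, Option.mem_def]
    exact exists_comm

theorem REPred.comp {p : β → Prop} {f : α → β} (hp : REPred p) (hf : Computable f) :
    REPred fun a => p (f a) :=
  Partrec.comp hp hf

/-- Dovetailing: a single number codes a candidate witness together with a stage. -/
theorem REPred.exists {p : α × β → Prop} (hp : REPred p) : REPred fun a => ∃ b, p (a, b) := by
  classical
  obtain ⟨R, hR, -, hpR⟩ := hp.exists_primrecRel
  have h : PrimrecRel fun (a : α) (k : ℕ) =>
      ∃ b ∈ (Encodable.decode (α := β) k.unpair.1).toList, R (a, b) k.unpair.2 := by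
    have h1 : PrimrecRel fun (b : β) (x : α × ℕ) => R (x.1, b) x.2 :=
      hR.comp (Primrec.pair (Primrec.fst.comp Primrec.snd) Primrec.fst)
        (Primrec.snd.comp Primrec.snd)
    exact h1.exists_mem_list.comp
      (Primrec.optionToList.comp (Primrec.decode.comp
        (Primrec.fst.comp (Primrec.unpair.comp Primrec.snd))))
      (Primrec.pair Primrec.fst (Primrec.snd.comp (Primrec.unpair.comp Primrec.snd)))
  refine h.rePred_exists_nat.of_eq fun a => ⟨?_, ?_⟩
  · rintro ⟨k, b, -, hb⟩
    exact ⟨b, (hpR _).2 ⟨_, hb⟩⟩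
  · rintro ⟨b, hb⟩
    obtain ⟨n, hn⟩ := (hpR _).1 hb
    exact ⟨Nat.pair (Encodable.encode b) n, b, by simp, by simpa using hn⟩

theorem REPred.and {p q : α → Prop} (hp : REPred p) (hq : REPred q) :
    REPred fun a => p a ∧ q a := by
  obtain ⟨R, hR, hRm, hpR⟩ := hp.exists_primrecRel
  obtain ⟨S, hS, hSm, hqS⟩ := hq.exists_primrecRel
  have h : PrimrecRel fun a n => R a n ∧ S a n := PrimrecPred.and hR hS
  refine h.rePred_exists_nat.of_eq fun a => ⟨?_, ?_⟩
  · rintro ⟨n, h1, h2⟩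
    exact ⟨(hpR a).2 ⟨n, h1⟩, (hqS a).2 ⟨n, h2⟩⟩
  · rintro ⟨h1, h2⟩
    obtain ⟨m, hm⟩ := (hpR a).1 h1
    obtain ⟨n, hn⟩ := (hqS a).1 h2
    exact ⟨max m n, hRm _ _ _ (le_max_left _ _) hm, hSm _ _ _ (le_max_right _ _) hn⟩

theorem REPred.forall_mem_list {p : β × γ → Prop} (hp : REPred p) :
    REPred fun x : List β × γ => ∀ b ∈ x.1, p (b, x.2) := by
  obtain ⟨R, hR, hRm, hpR⟩ := hp.exists_primrecRel
  have h : PrimrecRel fun (x : List β × γ) (n : ℕ) => ∀ b ∈ x.1, R (b, x.2) n := by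
    have h1 : PrimrecRel fun (b : β) (y : γ × ℕ) => R (b, y.1) y.2 :=
      hR.comp (Primrec.pair Primrec.fst (Primrec.fst.comp Primrec.snd))
        (Primrec.snd.comp Primrec.snd)
    exact h1.forall_mem_list.comp (Primrec.fst.comp Primrec.fst)
      (Primrec.pair (Primrec.snd.comp Primrec.fst) Primrec.snd)
  refine h.rePred_exists_nat.of_eq fun ⟨l, c⟩ => ⟨?_, fun H => ?_⟩
  · rintro ⟨n, hn⟩ b hb
    exact (hpR _).2 ⟨n, hn b hb⟩
  · dsimp only at H ⊢
    induction l with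
    | nil => exact ⟨0, by simp⟩
    | cons b l ih =>
      obtain ⟨m, hm⟩ := (hpR _).1 (H b (by simp))
      obtain ⟨n, hn⟩ := ih fun b' hb' => H b' (by simp [hb'])
      refine ⟨max m n, fun b' hb' => ?_⟩
      rcases List.mem_cons.1 hb' with rfl | hb'
      · exact hRm _ _ _ (le_max_left _ _) hm
      · exact hRm _ _ _ (le_max_right _ _) (hn _ hb')

theorem PrimrecPred.rePred {p : α → Prop} (hp : PrimrecPred p) : REPred p := by
  classical
  exact ComputablePred.to_re ⟨inferInstance, hp.decide.to_comp⟩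

theorem primrec_consecutivePairs : Primrec (consecutivePairs (β := β)) := by
  refine Primrec.list_rec (f := fun l : List β => l) (g := fun _ => ([] : List (β × β)))
    (h := fun _ x => (x.2.1.head?.map (Prod.mk x.1)).toList ++ x.2.2)
    Primrec.id (Primrec.const _) ?_
  refine Primrec.list_append.comp (Primrec.optionToList.comp ?_)
    (Primrec.snd.comp (Primrec.snd.comp Primrec.snd))
  exact Primrec.option_map
    (Primrec.list_head?.comp (Primrec.fst.comp (Primrec.snd.comp Primrec.snd)))
    (Primrec.pair (Primrec.fst.comp (Primrec.snd.comp Primrec.fst)) Primrec.snd)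

theorem REPred.iterRel {R : β → β → Prop} (hR : REPred fun e : β × β => R e.1 e.2) :
    REPred fun x : ℕ × β => IterRel R x.1 x.2 := by
  have h1 : REPred fun x : (ℕ × β) × List β => x.2.length = x.1.1 :=
    PrimrecPred.rePred (Primrec.eq.comp (Primrec.list_length.comp Primrec.snd)
      (Primrec.fst.comp Primrec.fst))
  have h2 : REPred fun x : (β × β) × Unit => R x.1.2 x.1.1 :=
    hR.comp (f := fun x : (β × β) × Unit => (x.1.2, x.1.1))
      (Computable.pair (Computable.snd.comp Computable.fst) (Computable.fst.comp Computable.fst))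
  have h3 : REPred fun x : (ℕ × β) × List β =>
      ∀ e ∈ consecutivePairs (x.1.2 :: x.2), R e.2 e.1 :=
    h2.forall_mem_list.comp (f := fun x : (ℕ × β) × List β =>
      (consecutivePairs (x.1.2 :: x.2), ()))
      (Primrec.pair (primrec_consecutivePairs.comp
        (Primrec.list_cons.comp (Primrec.snd.comp Primrec.fst) Primrec.snd))
        (Primrec.const ())).to_comp
  exact (h1.and h3).exists.of_eq fun x => (iterRel_iff_exists_list R x.1 x.2).symm

theorem Computable.sum_map {f : β × γ → ℕ} (hf : Computable f) :
    Computable fun x : List β × γ => (x.1.map fun b => f (b, x.2)).sum := by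
  -- Recursion on the index; the default `0` lets an index outside the list contribute nothing.
  have h : Computable fun x : List β × γ =>
      Nat.rec (motive := fun _ => ℕ) 0
        (fun i s => s + ((x.1[i]?).map fun b => f (b, x.2)).getD 0) x.1.length := by
    refine Computable.nat_rec (f := fun x : List β × γ => x.1.length) (g := fun _ => 0)
      (h := fun x y => y.2 + ((x.1[y.1]?).map fun b => f (b, x.2)).getD 0)
      (Computable.list_length.comp Computable.fst) (Computable.const 0) ?_
    refine (Primrec.nat_add.to_comp).comp (Computable.snd.comp Computable.snd) ?_
    refine Computable.option_getD (Computable.option_map ?_ ?_) (Computable.const 0)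
    · exact Computable.list_getElem?.comp (Computable.fst.comp Computable.fst)
        (Computable.fst.comp Computable.snd)
    · exact hf.comp (Computable.pair Computable.snd
        (Computable.snd.comp (Computable.fst.comp Computable.fst)))
  refine h.of_eq fun ⟨l, c⟩ => ?_
  have key : ∀ n, Nat.rec (motive := fun _ => ℕ) 0
      (fun i s => s + ((l[i]?).map fun b => f (b, c)).getD 0) n
        = ((l.take n).map fun b => f (b, c)).sum := by
    intro n
    induction n with
    | zero => simp
    | succ n ih =>
      rw [List.take_add_one, List.map_append, List.sum_append, ← ih]
      cases hn : l[n]? <;> simp [hn]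
  simpa using key l.length

theorem primrecPred_nodup : PrimrecPred fun l : List β => l.Nodup := by
  classical
  have h1 : PrimrecRel fun (b : β) (l : List β) => (l.filter (· = b)).length ≤ 1 :=
    Primrec.nat_le.comp (Primrec.list_length.comp
      (Primrec.eq.listFilter.comp Primrec.snd Primrec.fst)) (Primrec.const 1)
  refine (h1.forall_mem_list.comp Primrec.id Primrec.id).of_eq fun l => ?_
  rw [List.nodup_iff_count_le_one]
  have h2 : ∀ b, (l.filter (· = b)).length = l.count b := fun b => by
    rw [List.count, List.countP_eq_length_filter]; congr 1
  simp only [id, h2]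
  refine ⟨fun h b => ?_, fun h b _ => h b⟩
  by_cases hb : b ∈ l
  · exact h b hb
  · simp [List.count_eq_zero.2 hb]

theorem primrecRel_isPrefix [DecidableEq β] :
    PrimrecRel fun l₁ l₂ : List β => l₁ <+: l₂ :=
  (Primrec.eq.comp Primrec.fst
    (Primrec.list_take.comp (Primrec.list_length.comp Primrec.fst) Primrec.snd)).of_eq
      fun _ => List.prefix_iff_eq_take.symm

theorem countable_setOf_rePred : {p : α → Prop | REPred p}.Countable := by
  refine (Set.countable_range fun (c : Nat.Partrec.Code) (a : α) =>
    (Nat.Partrec.Code.eval c (Encodable.encode a)).Dom).mono ?_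
  intro p hp
  obtain ⟨c, hc⟩ := Nat.Partrec.Code.exists_code.1 hp
  refine ⟨c, funext fun a => propext ?_⟩
  dsimp only
  rw [hc]; simp [Part.assert, Part.bind, Part.map]

end RecursivelyEnumerable

/-! ### Cylinders and measures on the Cantor space -/

section CantorSpace

theorem length_initSeg (α : Cantor) (n : ℕ) : (initSeg α n).length = n := by
  simp [initSeg]

theorem mem_cyl {α : Cantor} {a : List Bool} : α ∈ cyl a ↔ initSeg α a.length = a := Iff.rfl

theorem mem_cyl_initSeg (α : Cantor) (n : ℕ) : α ∈ cyl (initSeg α n) := by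
  rw [mem_cyl, length_initSeg]

theorem cyl_nil : cyl [] = Set.univ := by
  ext α; simp [mem_cyl, initSeg]

theorem take_initSeg (α : Cantor) {m n : ℕ} (h : m ≤ n) :
    (initSeg α n).take m = initSeg α m := by
  simp [initSeg, ← List.map_take, List.take_range, h]

theorem initSeg_prefix_initSeg (α : Cantor) {m n : ℕ} (h : m ≤ n) :
    initSeg α m <+: initSeg α n := by
  rw [← take_initSeg α h]; exact List.take_prefix _ _

theorem prefix_initSeg_iff {α : Cantor} {a : List Bool} {n : ℕ} :
    a <+: initSeg α n ↔ a.length ≤ n ∧ α ∈ cyl a := by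
  constructor
  · intro h
    have hl : a.length ≤ n := by simpa [length_initSeg] using h.length_le
    refine ⟨hl, ?_⟩
    rw [mem_cyl, ← take_initSeg α hl]
    exact (List.prefix_iff_eq_take.1 h).symm
  · rintro ⟨hl, h⟩
    rw [mem_cyl] at h
    rw [← h]; exact initSeg_prefix_initSeg α hl

theorem mem_cyl_of_prefix_initSeg {α : Cantor} {a : List Bool} {n : ℕ}
    (h : a <+: initSeg α n) : α ∈ cyl a :=
  (prefix_initSeg_iff.1 h).2

theorem cyl_subset_cyl {a b : List Bool} (h : a <+: b) : cyl b ⊆ cyl a := by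
  intro α hα
  rw [mem_cyl] at hα
  rw [← hα] at h
  exact mem_cyl_of_prefix_initSeg h

theorem prefix_or_prefix_of_mem_cyl {α : Cantor} {a b : List Bool} (ha : α ∈ cyl a)
    (hb : α ∈ cyl b) : a <+: b ∨ b <+: a := by
  rcases le_total a.length b.length with h | h
  · left; rw [← mem_cyl.1 hb]; exact prefix_initSeg_iff.2 ⟨h, ha⟩
  · right; rw [← mem_cyl.1 ha]; exact prefix_initSeg_iff.2 ⟨h, hb⟩

theorem isClopen_cyl (a : List Bool) : IsClopen (cyl a) := by
  have h : cyl a = ⋂ i : Fin a.length, {α : Cantor | α i = a[i]} := by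
    ext α
    simp only [mem_cyl, Set.mem_iInter, Set.mem_ofPred_eq]
    constructor
    · intro h i
      have := List.getElem_of_eq h.symm i.2
      simpa [initSeg] using this.symm
    · intro h
      refine List.ext_getElem (length_initSeg _ _) fun i h1 h2 => ?_
      simpa [initSeg] using h ⟨i, h2⟩
  rw [h]
  refine isClopen_iInter_of_finite fun i => ?_
  exact (isClopen_discrete {a[i]}).preimage (continuous_apply (i : ℕ))

theorem measurableSet_cyl (a : List Bool) : MeasurableSet (cyl a) :=
  (isClopen_cyl a).isOpen.measurableSet

theorem isPiSystem_range_cyl : IsPiSystem (Set.range cyl) := by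
  rintro _ ⟨a, rfl⟩ _ ⟨b, rfl⟩ ⟨α, ha, hb⟩
  rcases prefix_or_prefix_of_mem_cyl ha hb with h | h
  · exact ⟨b, (Set.inter_eq_right.2 (cyl_subset_cyl h)).symm⟩
  · exact ⟨a, (Set.inter_eq_left.2 (cyl_subset_cyl h)).symm⟩

theorem generateFrom_range_cyl :
    (inferInstance : MeasurableSpace Cantor) = MeasurableSpace.generateFrom (Set.range cyl) := by
  apply le_antisymm
  · refine iSup_le fun i => ?_
    rw [← measurable_iff_comap_le]
    refine @measurable_to_countable' _ _ _ _ (_) _ fun x => ?_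
    have h : (fun α : Cantor => α i) ⁻¹' {x} =
        ⋃ a ∈ {a : List Bool | a.length = i + 1 ∧ a[i]? = some x}, cyl a := by
      ext α
      simp only [Set.mem_preimage, Set.mem_singleton_iff, Set.mem_iUnion, Set.mem_ofPred_eq,
        exists_prop]
      constructor
      · intro h
        exact ⟨initSeg α (i + 1), ⟨length_initSeg _ _, by simp [initSeg, h]⟩,
          mem_cyl_initSeg _ _⟩
      · rintro ⟨a, ⟨ha, hx⟩, h⟩
        rw [mem_cyl, ha] at h
        rw [← h] at hx
        simpa [initSeg] using hx
    rw [h]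
    exact MeasurableSet.biUnion (Set.to_countable _) fun a _ =>
      MeasurableSpace.measurableSet_generateFrom ⟨a, rfl⟩
  · refine MeasurableSpace.generateFrom_le ?_
    rintro _ ⟨a, rfl⟩
    exact measurableSet_cyl a

theorem measure_ext_cyl {μ ν : Measure Cantor} [IsFiniteMeasure μ]
    (h : ∀ a, μ (cyl a) = ν (cyl a)) : μ = ν := by
  refine ext_of_generate_finite (Set.range cyl) generateFrom_range_cyl isPiSystem_range_cyl ?_ ?_
  · rintro _ ⟨a, rfl⟩
    exact h a
  · rw [← cyl_nil]; exact h []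

/-- The prefix-minimal strings of `A` have pairwise disjoint cylinders with the same union, so the
inequality can be summed over them. -/
theorem measure_iUnion_cyl_le {μ ν : Measure Cantor} {A : Set (List Bool)}
    (h : ∀ a ∈ A, μ (cyl a) ≤ ν (cyl a)) : μ (⋃ a ∈ A, cyl a) ≤ ν (⋃ a ∈ A, cyl a) := by
  let M : Set (List Bool) := {a | a ∈ A ∧ ∀ b ∈ A, b <+: a → b = a}
  have hM : ∀ a ∈ A, ∃ b ∈ M, b <+: a := by
    intro a
    induction hn : a.length using Nat.strong_induction_on generalizing a with
    | _ n ih =>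
      intro ha
      by_cases hmin : ∀ b ∈ A, b <+: a → b = a
      · exact ⟨a, ⟨ha, hmin⟩, List.prefix_rfl⟩
      · push Not at hmin
        obtain ⟨b, hb, hba, hne⟩ := hmin
        have hlt : b.length < n := by
          rw [← hn]
          exact lt_of_le_of_ne hba.length_le fun e => hne (hba.eq_of_length e)
        obtain ⟨c, hc, hcb⟩ := ih _ hlt b rfl hb
        exact ⟨c, hc, hcb.trans hba⟩
  have hU : (⋃ a ∈ A, cyl a) = ⋃ a ∈ M, cyl a := by
    apply Set.Subset.antisymm
    · refine Set.iUnion₂_subset fun a ha => ?_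
      obtain ⟨b, hb, hba⟩ := hM a ha
      exact (cyl_subset_cyl hba).trans (Set.subset_biUnion_of_mem (u := cyl) hb)
    · exact Set.biUnion_subset_biUnion_left fun a ha => ha.1
  have hd : M.PairwiseDisjoint cyl := by
    intro a ha b hb hne
    refine Set.disjoint_left.2 fun α h1 h2 => hne ?_
    rcases prefix_or_prefix_of_mem_cyl h1 h2 with h | h
    · exact hb.2 a ha.1 h
    · exact (ha.2 b hb.1 h).symm
  rw [hU, measure_biUnion (Set.to_countable M) hd fun a _ => measurableSet_cyl a,
    measure_biUnion (Set.to_countable M) hd fun a _ => measurableSet_cyl a]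
  exact ENNReal.tsum_le_tsum fun a => h a a.2.1

theorem mul_measureReal_iUnion_cyl_le {μ ν : Measure Cantor} [IsFiniteMeasure μ]
    [IsFiniteMeasure ν] {A : Set (List Bool)} {x y : ℝ} (hx : 0 ≤ x) (hy : 0 ≤ y)
    (h : ∀ a ∈ A, x * μ.real (cyl a) ≤ y * ν.real (cyl a)) :
    x * μ.real (⋃ a ∈ A, cyl a) ≤ y * ν.real (⋃ a ∈ A, cyl a) := by
  have key : ∀ s : Set Cantor, (x * μ.real s ≤ y * ν.real s ↔
      (ENNReal.ofReal x • μ) s ≤ (ENNReal.ofReal y • ν) s) := by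
    intro s
    rw [Measure.smul_apply, Measure.smul_apply, smul_eq_mul, smul_eq_mul,
      ← ofReal_measureReal (μ := μ), ← ofReal_measureReal (μ := ν), ← ENNReal.ofReal_mul hx,
      ← ENNReal.ofReal_mul hy, ENNReal.ofReal_le_ofReal_iff (by positivity)]
  rw [key]
  exact measure_iUnion_cyl_le fun a ha => (key _).1 (h a ha)

end CantorSpace

/-! ### Marginals on cylinders and semidecidable comparisons -/

section Marginals

theorem measurableSet_rect (p : List Bool × List Bool) : MeasurableSet (rect p) :=
  (measurableSet_cyl _).prod (measurableSet_cyl _)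

theorem fst_cyl (P : Measure (Cantor × Cantor)) (a : List Bool) :
    P.fst (cyl a) = P (rect (a, [])) := by
  rw [Measure.fst_apply (measurableSet_cyl a), rect, cyl_nil, Set.prod_univ]

theorem fst_restrict_cyl (P : Measure (Cantor × Cantor)) (S : Set (Cantor × Cantor))
    (a : List Bool) : (P.restrict S).fst (cyl a) = P (cyl a ×ˢ Set.univ ∩ S) := by
  rw [Measure.fst_apply (measurableSet_cyl a),
    Measure.restrict_apply (measurable_fst (measurableSet_cyl a)), Set.prod_univ]

end Marginals

/-- A strict inequality between computable reals is eventually confirmed by approximations, since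
the error at precision `n` is at most the list length times `2^(-n)`. -/
theorem IsComputableMeasure.rePred_sum_lt_sum {P : Measure (Cantor × Cantor)}
    (hP : IsComputableMeasure P) :
    REPred fun x : (List (List Bool × List Bool) × ℕ) × (List (List Bool × List Bool) × ℕ) =>
      x.1.2 * (x.1.1.map fun p => P.real (rect p)).sum <
        x.2.2 * (x.2.1.map fun p => P.real (rect p)).sum := by
  obtain ⟨f, hf, hfP⟩ := hP
  let S : List (List Bool × List Bool) × ℕ → ℕ := fun x => (x.1.map fun p => f (p, x.2)).sum
  have hS : Computable S := hf.sum_map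
  have hSP : ∀ D n, |2 ^ n * (D.map fun p => P.real (rect p)).sum - S (D, n)| ≤ D.length := by
    intro D n
    induction D with
    | nil => simp [S]
    | cons p D ih =>
      have h1 : |2 ^ n * P.real (rect p) - f (p, n)| ≤ 1 := by
        have h2 := hfP p n
        have h3 : P.real (rect p) - (f (p, n) : ℝ) / 2 ^ n =
            (2 ^ n * P.real (rect p) - f (p, n)) / 2 ^ n := by field_simp
        rw [h3, abs_div, abs_of_pos (by positivity : (0 : ℝ) < 2 ^ n)] at h2
        exact (div_le_div_iff_of_pos_right (by positivity)).1 h2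
      have h2 : (S (p :: D, n) : ℝ) = f (p, n) + S (D, n) := by simp [S]
      rw [List.map_cons, List.sum_cons, List.length_cons, h2]
      rw [abs_le] at *
      push_cast
      constructor <;> linarith
  -- Scaled by `2^n`, the upper estimate of the left side is compared with the lower estimate of the
  -- right side.
  have hre : REPred fun x : ((List (List Bool × List Bool) × ℕ) ×
      (List (List Bool × List Bool) × ℕ)) × ℕ =>
      x.1.1.2 * (S (x.1.1.1, x.2) + x.1.1.1.length) + x.1.2.2 * x.1.2.1.length <
        x.1.2.2 * S (x.1.2.1, x.2) := by
    refine ComputablePred.to_re ⟨inferInstance, ?_⟩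
    have hadd := Primrec.nat_add.to_comp
    have hmul := Primrec.nat_mul.to_comp
    have h1 : Computable fun x : ((List (List Bool × List Bool) × ℕ) ×
      (List (List Bool × List Bool) × ℕ)) × ℕ => x.1.1 := Computable.fst.comp Computable.fst
    have h2 : Computable fun x : ((List (List Bool × List Bool) × ℕ) ×
      (List (List Bool × List Bool) × ℕ)) × ℕ => x.1.2 := Computable.snd.comp Computable.fst
    have hl := Computable.list_length (α := List Bool × List Bool)
    refine Primrec.nat_lt.decide.to_comp.comp (hadd.comp (hmul.comp (Computable.snd.comp h1)
      (hadd.comp (hS.comp (Computable.pair (Computable.fst.comp h1) Computable.snd))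
        (hl.comp (Computable.fst.comp h1))))
      (hmul.comp (Computable.snd.comp h2) (hl.comp (Computable.fst.comp h2)))) ?_
    exact hmul.comp (Computable.snd.comp h2)
      (hS.comp (Computable.pair (Computable.fst.comp h2) Computable.snd))
  refine hre.exists.of_eq fun ⟨⟨D, A⟩, ⟨E, B⟩⟩ => ?_
  dsimp only
  set s := (D.map fun p => P.real (rect p)).sum
  set t := (E.map fun p => P.real (rect p)).sum
  constructor
  · rintro ⟨n, hn⟩
    have hn' : (A : ℝ) * (S (D, n) + D.length) + B * E.length < B * S (E, n) := by
      exact_mod_cast hn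
    have h1 := (abs_le.1 (hSP D n)).2
    have h2 := (abs_le.1 (hSP E n)).1
    have h3 : (A : ℝ) * (2 ^ n * s) ≤ A * (S (D, n) + D.length) :=
      mul_le_mul_of_nonneg_left (by linarith) (Nat.cast_nonneg _)
    have h4 : (B : ℝ) * S (E, n) ≤ B * (2 ^ n * t + E.length) :=
      mul_le_mul_of_nonneg_left (by linarith) (Nat.cast_nonneg _)
    have h5 : (2 : ℝ) ^ n * (A * s) < 2 ^ n * (B * t) := by linarith
    exact lt_of_mul_lt_mul_left h5 (by positivity)
  · intro h
    -- At this precision the scaled gap exceeds twice the total error: each sum is off once from its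
    -- true value and once more from the safety margin.
    obtain ⟨n, hn⟩ := pow_unbounded_of_one_lt
      ((2 * A * D.length + 2 * B * E.length) / (B * t - A * s)) (one_lt_two (α := ℝ))
    rw [div_lt_iff₀ (by linarith)] at hn
    refine ⟨n, ?_⟩
    have h1 := (abs_le.1 (hSP D n)).1
    have h2 := (abs_le.1 (hSP E n)).2
    have h3 : (A : ℝ) * S (D, n) ≤ A * (2 ^ n * s + D.length) :=
      mul_le_mul_of_nonneg_left (by linarith) (Nat.cast_nonneg _)
    have h4 : (B : ℝ) * (2 ^ n * t - E.length) ≤ B * S (E, n) :=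
      mul_le_mul_of_nonneg_left (by linarith) (Nat.cast_nonneg _)
    have : (A : ℝ) * (S (D, n) + D.length) + B * E.length < B * S (E, n) := by linarith
    exact_mod_cast this

/-! ### Effective upcrossing inequality and convergence of the ratios -/

section Upcrossings

variable {P : Measure (Cantor × Cantor)}

theorem IsComputableMeasure.rePred_mul_lt_mul (hP : IsComputableMeasure P) {α : Type*}
    [Primcodable α] {p q : α → List Bool × List Bool} {x y : α → ℕ} (hp : Computable p)
    (hq : Computable q) (hx : Computable x) (hy : Computable y) :
    REPred fun a => x a * P.real (rect (p a)) < y a * P.real (rect (q a)) := by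
  have hs : ∀ {r : α → List Bool × List Bool}, Computable r → Computable fun a => [r a] :=
    fun hr => Computable.list_cons.comp hr (Computable.const [])
  refine (hP.rePred_sum_lt_sum.comp (f := fun a => (([p a], x a), ([q a], y a)))
    (Computable.pair (Computable.pair (hs hp) hx) (Computable.pair (hs hq) hy))).of_eq
      fun a => ?_
  simp

/-- On the way from `c` to its extension `a` the conditional probability of `[b]` given the
first coordinate is first below `q₁ / q₂` and then, at `a`, above `r₁ / r₂`. -/
def UpcrossingStep (P : Measure (Cantor × Cantor)) (b : List Bool) (q₁ q₂ r₁ r₂ : ℕ)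
    (c a : List Bool) : Prop :=
  ∃ u, (c <+: u ∧ u <+: a) ∧ q₂ * P.real (rect (u, b)) < q₁ * P.real (rect (u, [])) ∧
    r₁ * P.real (rect (a, [])) < r₂ * P.real (rect (a, b))

theorem IsComputableMeasure.rePred_upcrossingStep (hP : IsComputableMeasure P) (b : List Bool)
    (q₁ q₂ r₁ r₂ : ℕ) :
    REPred fun e : List Bool × List Bool => UpcrossingStep P b q₁ q₂ r₁ r₂ e.1 e.2 := by
  have hca : Computable fun x : (List Bool × List Bool) × List Bool => x.1.2 :=
    Computable.snd.comp Computable.fst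
  refine REPred.exists (p := fun x : (List Bool × List Bool) × List Bool =>
    (x.1.1 <+: x.2 ∧ x.2 <+: x.1.2) ∧
      q₂ * P.real (rect (x.2, b)) < q₁ * P.real (rect (x.2, [])) ∧
      r₁ * P.real (rect (x.1.2, [])) < r₂ * P.real (rect (x.1.2, b)))
    (REPred.and ?_ (REPred.and ?_ ?_))
  · exact PrimrecPred.rePred (PrimrecPred.and
      (primrecRel_isPrefix.comp (Primrec.fst.comp Primrec.fst) Primrec.snd)
      (primrecRel_isPrefix.comp Primrec.snd (Primrec.snd.comp Primrec.fst)))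
  · exact hP.rePred_mul_lt_mul (Computable.pair Computable.snd (Computable.const b))
      (Computable.pair Computable.snd (Computable.const [])) (Computable.const q₂)
      (Computable.const q₁)
  · exact hP.rePred_mul_lt_mul (Computable.pair hca (Computable.const []))
      (Computable.pair hca (Computable.const b)) (Computable.const r₁) (Computable.const r₂)

/-- The open set of sequences along which at least `k` upcrossings occur. -/
def upcrossingSet (P : Measure (Cantor × Cantor)) (b : List Bool) (q₁ q₂ r₁ r₂ k : ℕ) :
    Set Cantor :=
  ⋃ a ∈ {a | IterRel (UpcrossingStep P b q₁ q₂ r₁ r₂) k a}, cyl a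

/-- With `ν` the part of `P` over `[b]`, projected to the first coordinate, the next upcrossing set
has marginal at most `r₂/r₁` times its `ν`-measure. It is covered by cylinders where the ratio is
below `q₁/q₂`, and these lie in the previous set. -/
theorem real_upcrossingSet_succ_le [IsFiniteMeasure P] (b : List Bool) (q₁ q₂ r₁ r₂ k : ℕ) :
    (r₁ * q₂ : ℝ) * P.fst.real (upcrossingSet P b q₁ q₂ r₁ r₂ (k + 1)) ≤
      q₁ * r₂ * P.fst.real (upcrossingSet P b q₁ q₂ r₁ r₂ k) := by
  set V := upcrossingSet P b q₁ q₂ r₁ r₂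
  let ν : Measure Cantor := (P.restrict (Set.univ ×ˢ cyl b)).fst
  have hμ : ∀ a, P.fst.real (cyl a) = P.real (rect (a, [])) := fun a => by
    rw [measureReal_def, measureReal_def, fst_cyl]
  have hν : ∀ a, ν.real (cyl a) = P.real (rect (a, b)) := fun a => by
    rw [measureReal_def, measureReal_def, fst_restrict_cyl, Set.prod_inter_prod]
    simp [rect]
  -- The low points reached after `k` upcrossings; their union is squeezed between `V (k + 1)` and
  -- `V k`.
  let A : Set (List Bool) := {u | q₂ * P.real (rect (u, b)) < q₁ * P.real (rect (u, [])) ∧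
    ∃ c, IterRel (UpcrossingStep P b q₁ q₂ r₁ r₂) k c ∧ c <+: u}
  have hUV : (⋃ a ∈ A, cyl a) ⊆ V k := by
    refine Set.iUnion₂_subset ?_
    rintro u ⟨-, c, hc, hcu⟩
    exact (cyl_subset_cyl hcu).trans (Set.subset_biUnion_of_mem (u := cyl) hc)
  have hVU : V (k + 1) ⊆ ⋃ a ∈ A, cyl a := by
    refine Set.iUnion₂_subset ?_
    rintro a ⟨c, hc, u, ⟨hcu, hua⟩, hu, -⟩
    exact (cyl_subset_cyl hua).trans
      (Set.subset_biUnion_of_mem (u := cyl) (show u ∈ A from ⟨hu, c, hc, hcu⟩))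
  have h1 : (r₁ : ℝ) * P.fst.real (V (k + 1)) ≤ r₂ * ν.real (V (k + 1)) := by
    refine mul_measureReal_iUnion_cyl_le (Nat.cast_nonneg _) (Nat.cast_nonneg _) ?_
    rintro a ⟨c, -, u, -, -, h⟩
    rw [hμ, hν]; exact h.le
  have h2 : (q₂ : ℝ) * ν.real (⋃ a ∈ A, cyl a) ≤ q₁ * P.fst.real (⋃ a ∈ A, cyl a) := by
    refine mul_measureReal_iUnion_cyl_le (Nat.cast_nonneg _) (Nat.cast_nonneg _) ?_
    rintro a ⟨h, -⟩
    rw [hμ, hν]; exact h.le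
  have h3 : ν.real (V (k + 1)) ≤ ν.real (⋃ a ∈ A, cyl a) := measureReal_mono hVU (measure_ne_top _ _)
  have h4 : P.fst.real (⋃ a ∈ A, cyl a) ≤ P.fst.real (V k) := measureReal_mono hUV (measure_ne_top _ _)
  calc (r₁ * q₂ : ℝ) * P.fst.real (V (k + 1)) = q₂ * (r₁ * P.fst.real (V (k + 1))) := by ring
    _ ≤ q₂ * (r₂ * ν.real (⋃ a ∈ A, cyl a)) := mul_le_mul_of_nonneg_left
        (h1.trans (mul_le_mul_of_nonneg_left h3 (by positivity))) (by positivity)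
    _ = r₂ * (q₂ * ν.real (⋃ a ∈ A, cyl a)) := by ring
    _ ≤ r₂ * (q₁ * P.fst.real (V k)) := mul_le_mul_of_nonneg_left
        (h2.trans (mul_le_mul_of_nonneg_left h4 (by positivity))) (by positivity)
    _ = _ := by ring

theorem real_upcrossingSet_le [IsProbabilityMeasure P] (b : List Bool) {q₁ q₂ r₁ r₂ : ℕ}
    (h : q₁ * r₂ < r₁ * q₂) (k : ℕ) :
    P.fst.real (upcrossingSet P b q₁ q₂ r₁ r₂ k) ≤ ((q₁ * r₂ : ℝ) / (r₁ * q₂)) ^ k := by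
  have hpos : (0 : ℝ) < r₁ * q₂ := by exact_mod_cast (Nat.zero_le _).trans_lt h
  induction k with
  | zero => simp
  | succ k ih =>
    have h1 := real_upcrossingSet_succ_le (P := P) b q₁ q₂ r₁ r₂ k
    rw [mul_comm, ← le_div_iff₀ hpos] at h1
    refine h1.trans ?_
    rw [pow_succ, mul_div_right_comm, mul_comm]
    gcongr

theorem IsMLRandom.exists_notMem_upcrossingSet [IsProbabilityMeasure P]
    (hP : IsComputableMeasure P) {α : Cantor} (hα : IsMLRandom cyl P.fst α) (b : List Bool)
    {q₁ q₂ r₁ r₂ : ℕ} (h : q₁ * r₂ < r₁ * q₂) :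
    ∃ k, α ∉ upcrossingSet P b q₁ q₂ r₁ r₂ k := by
  have hpos : (0 : ℝ) < r₁ * q₂ := by exact_mod_cast (Nat.zero_le _).trans_lt h
  have hlt : (q₁ * r₂ : ℝ) / (r₁ * q₂) < 1 := by
    rw [div_lt_one hpos]; exact_mod_cast h
  -- Every `C` upcrossings at least halve the bound, so the sets with index `C * n` form a test.
  obtain ⟨C, hC⟩ := exists_pow_lt_of_lt_one (by norm_num : (0 : ℝ) < 1 / 2) hlt
  have htest : IsMLTest cyl P.fst fun n => upcrossingSet P b q₁ q₂ r₁ r₂ (C * n) := by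
    refine ⟨⟨fun x => IterRel (UpcrossingStep P b q₁ q₂ r₁ r₂) (C * x.1) x.2, ?_, fun n => rfl⟩,
      fun n => ?_⟩
    · exact (hP.rePred_upcrossingStep b q₁ q₂ r₁ r₂).iterRel.comp
        (f := fun x : ℕ × List Bool => (C * x.1, x.2))
        (Primrec.pair (Primrec.nat_mul.comp (Primrec.const C) Primrec.fst) Primrec.snd).to_comp
    · have h1 : P.fst.real (upcrossingSet P b q₁ q₂ r₁ r₂ (C * n)) ≤ (2 ^ n)⁻¹ := by
        refine (real_upcrossingSet_le b h _).trans ?_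
        rw [pow_mul, ← inv_pow, ← one_div]
        gcongr
      rw [← ofReal_measureReal (μ := P.fst)]
      refine (ENNReal.ofReal_le_ofReal h1).trans_eq ?_
      rw [ENNReal.ofReal_inv_of_pos (by positivity), ENNReal.ofReal_pow (by norm_num)]
      simp
  have := hα _ htest
  simp only [Set.mem_iInter, not_forall] at this
  obtain ⟨n, hn⟩ := this
  exact ⟨_, hn⟩

theorem exists_iterRel_upcrossingStep {α : Cantor} {b : List Bool} {q₁ q₂ r₁ r₂ : ℕ}
    (hq : ∃ᶠ n in atTop, q₂ * P.real (rect (initSeg α n, b)) <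
      q₁ * P.real (rect (initSeg α n, [])))
    (hr : ∃ᶠ n in atTop, r₁ * P.real (rect (initSeg α n, [])) <
      r₂ * P.real (rect (initSeg α n, b))) (k : ℕ) :
    ∃ n, IterRel (UpcrossingStep P b q₁ q₂ r₁ r₂) k (initSeg α n) := by
  induction k with
  | zero => exact ⟨0, trivial⟩
  | succ k ih =>
    obtain ⟨n, hn⟩ := ih
    obtain ⟨m, hnm, hm⟩ := frequently_atTop.1 hq n
    obtain ⟨l, hml, hl⟩ := frequently_atTop.1 hr m
    exact ⟨l, _, hn, _, ⟨initSeg_prefix_initSeg α hnm, initSeg_prefix_initSeg α hml⟩, hm, hl⟩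

theorem IsMLRandom.fst_cyl_ne_zero {α : Cantor} (hα : IsMLRandom cyl P.fst α) (n : ℕ) :
    P.fst (cyl (initSeg α n)) ≠ 0 := by
  intro h0
  have htest : IsMLTest cyl P.fst fun _ => cyl (initSeg α n) := by
    refine ⟨⟨fun x => x.2 = initSeg α n, ?_, fun n => by simp⟩, fun n => by simp [h0]⟩
    exact PrimrecPred.rePred (Primrec.eq.comp Primrec.snd (Primrec.const _))
  exact hα _ htest (Set.mem_iInter.2 fun _ => mem_cyl_initSeg _ _)

theorem rect_subset_rect_nil (a b : List Bool) : rect (a, b) ⊆ rect (a, []) := by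
  rw [rect, rect, cyl_nil]
  exact Set.prod_mono_right (Set.subset_univ _)

theorem IsMLRandom.exists_tendsto [IsProbabilityMeasure P] (hP : IsComputableMeasure P)
    {α : Cantor} (hα : IsMLRandom cyl P.fst α) (b : List Bool) :
    ∃ L : ℝ≥0∞, Tendsto (fun n => P (rect (initSeg α n, b)) / P.fst (cyl (initSeg α n))) atTop
      (𝓝 L) := by
  have hpos : ∀ n, 0 < P.real (rect (initSeg α n, [])) := fun n => by
    rw [measureReal_def, ← fst_cyl]
    exact ENNReal.toReal_pos (hα.fst_cyl_ne_zero n) (measure_ne_top _ _)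
  let u : ℕ → ℝ := fun n => P.real (rect (initSeg α n, b)) / P.real (rect (initSeg α n, []))
  have hu0 : ∀ n, 0 ≤ u n := fun n => by positivity
  have hu1 : ∀ n, u n ≤ 1 := fun n =>
    div_le_one_of_le₀ (measureReal_mono (rect_subset_rect_nil _ _)) (hpos n).le
  have hu : ∃ L, Tendsto u atTop (𝓝 L) := by
    refine tendsto_of_no_upcrossings (Rat.denseRange_cast (𝕜 := ℝ)) ?_
      (isBoundedUnder_of ⟨1, hu1⟩) (isBoundedUnder_of ⟨0, hu0⟩)
    rintro _ ⟨q, rfl⟩ _ ⟨r, rfl⟩ hqr ⟨hq, hr⟩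
    obtain ⟨n, hn⟩ := hq.exists
    have hq0 : (0 : ℝ) < q := (hu0 n).trans_lt hn
    have hr0 : (0 : ℝ) < r := hq0.trans hqr
    -- Both levels are positive because the ratios are nonnegative, so natural numerators and
    -- denominators suffice.
    have hcast : ∀ x : ℚ, (0 : ℝ) < x → (x : ℝ) = (x.num.toNat : ℝ) / x.den := fun x hx => by
      have h0 : 0 ≤ x.num := Rat.num_nonneg.2 (by exact_mod_cast hx.le)
      have h1 : ((x.num.toNat : ℤ) : ℝ) = (x.num : ℝ) := by rw [Int.toNat_of_nonneg h0]
      rw [Rat.cast_def, ← h1, Int.cast_natCast]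
    have hqd : (0 : ℝ) < q.den := by exact_mod_cast q.den_pos
    have hrd : (0 : ℝ) < r.den := by exact_mod_cast r.den_pos
    rw [hcast q hq0, hcast r hr0, div_lt_div_iff₀ hqd hrd] at hqr
    obtain ⟨k, hk⟩ := hα.exists_notMem_upcrossingSet hP b
      (q₁ := q.num.toNat) (q₂ := q.den) (r₁ := r.num.toNat) (r₂ := r.den)
      (by exact_mod_cast hqr)
    obtain ⟨n, hn⟩ := exists_iterRel_upcrossingStep (P := P) (α := α) (b := b)
      (q₁ := q.num.toNat) (q₂ := q.den) (r₁ := r.num.toNat) (r₂ := r.den)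
      (hq.mono fun n hn => by
        rw [hcast q hq0, div_lt_div_iff₀ (hpos n) hqd] at hn; linarith)
      (hr.mono fun n hn => by
        rw [hcast r hr0, div_lt_div_iff₀ hrd (hpos n)] at hn; linarith) k
    exact hk (Set.mem_biUnion (show _ ∈ {a | _} from hn) (mem_cyl_initSeg α n))
  obtain ⟨L, hL⟩ := hu
  refine ⟨ENNReal.ofReal L, (ENNReal.tendsto_ofReal hL).congr fun n => ?_⟩
  simp only [u]
  rw [ENNReal.ofReal_div_of_pos (hpos n), ofReal_measureReal, ofReal_measureReal, fst_cyl]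

end Upcrossings

/-! ### Existence and uniqueness of the conditional measure -/

section ConditionalMeasure

variable {P : Measure (Cantor × Cantor)} {α : Cantor}

theorem IsConditionalMeasure.isProbabilityMeasure [IsFiniteMeasure P] {Q : Measure Cantor}
    (hQ : IsConditionalMeasure P α Q) : IsProbabilityMeasure Q := by
  refine ⟨?_⟩
  rw [← cyl_nil]
  refine tendsto_nhds_unique (hQ.2 []) (tendsto_const_nhds.congr fun n => ?_)
  rw [← fst_cyl, ENNReal.div_self (hQ.1 n) (measure_ne_top _ _)]

theorem IsConditionalMeasure.unique [IsFiniteMeasure P] {Q Q' : Measure Cantor}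
    (hQ : IsConditionalMeasure P α Q) (hQ' : IsConditionalMeasure P α Q') : Q = Q' := by
  have := hQ.isProbabilityMeasure
  exact measure_ext_cyl fun b => tendsto_nhds_unique (hQ.2 b) (hQ'.2 b)

/-- The normalized restrictions of `P` to prefixes of `α` have a weak limit along an ultrafilter by
compactness. Cylinders are clopen, so its values on them are the given limits. -/
theorem exists_isConditionalMeasure [IsFiniteMeasure P]
    (h0 : ∀ n, P.fst (cyl (initSeg α n)) ≠ 0)
    (hL : ∀ b : List Bool, ∃ L : ℝ≥0∞,
      Tendsto (fun n => P (rect (initSeg α n, b)) / P.fst (cyl (initSeg α n))) atTop (𝓝 L)) :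
    ∃ Q : Measure Cantor, IsConditionalMeasure P α Q := by
  let μ : ℕ → Measure Cantor := fun n =>
    (P.fst (cyl (initSeg α n)))⁻¹ • (P.restrict (cyl (initSeg α n) ×ˢ Set.univ)).snd
  have hμ : ∀ n b, μ n (cyl b) = P (rect (initSeg α n, b)) / P.fst (cyl (initSeg α n)) := by
    intro n b
    rw [Measure.smul_apply, Measure.snd_apply (measurableSet_cyl b),
      Measure.restrict_apply (measurable_snd (measurableSet_cyl b)), smul_eq_mul,
      ENNReal.div_eq_inv_mul, ← Set.univ_prod, Set.prod_inter_prod]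
    simp [rect]
  have hprob : ∀ n, IsProbabilityMeasure (μ n) := fun n => ⟨by
    rw [← cyl_nil, hμ, ← fst_cyl, ENNReal.div_self (h0 n) (measure_ne_top _ _)]⟩
  let ρ : ℕ → ProbabilityMeasure Cantor := fun n => ⟨μ n, hprob n⟩
  obtain ⟨Q, -, hQ⟩ := isCompact_univ.ultrafilter_le_nhds
    ((hyperfilter ℕ).map ρ) (by simp)
  have hρ : Tendsto ρ (hyperfilter ℕ : Filter ℕ) (𝓝 Q) := hQ
  refine ⟨Q, h0, fun b => ?_⟩
  obtain ⟨L, hLb⟩ := hL b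
  have h1 : Tendsto (fun n => (ρ n : Measure Cantor) (cyl b)) (hyperfilter ℕ : Filter ℕ)
      (𝓝 ((Q : Measure Cantor) (cyl b))) :=
    ProbabilityMeasure.tendsto_measure_of_null_frontier_of_tendsto' hρ
      (by rw [(isClopen_cyl b).frontier_eq, measure_empty])
  have h2 : Tendsto (fun n => (ρ n : Measure Cantor) (cyl b)) (hyperfilter ℕ : Filter ℕ)
      (𝓝 L) :=
    (hLb.mono_left Nat.hyperfilter_le_atTop).congr fun n => (hμ n b).symm
  rw [tendsto_nhds_unique h1 h2]
  exact hLb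

end ConditionalMeasure

/-! ### Sections of Martin-Löf tests -/

section Sections

variable {P : Measure (Cantor × Cantor)}

/-- Finitely many pairwise incompatible strings witness that, for the open set with index `k`
enumerated by `W`, the part above `[a]` has conditional measure more than `2 ^ (-m)`. -/
def IsHeavyPrefix (P : Measure (Cantor × Cantor)) (W : ℕ × (List Bool × List Bool) → Prop)
    (k m : ℕ) (a : List Bool) : Prop :=
  ∃ x : List (List Bool) × ℕ, x.1.Nodup ∧
    (∀ v ∈ x.1, ∃ w : List Bool × List Bool,
      W (k, w) ∧ w.1 <+: a ∧ w.2 <+: v ∧ v.length = x.2) ∧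
    P.real (rect (a, [])) < 2 ^ m * (x.1.map fun v => P.real (rect (a, v))).sum

theorem computable_two_pow : Computable fun m : ℕ => 2 ^ m :=
  ((Primrec₂.unpaired'.1 Nat.Primrec.pow).comp (Primrec.const 2) Primrec.id).to_comp

theorem IsComputableMeasure.rePred_isHeavyPrefix (hP : IsComputableMeasure P)
    {W : ℕ × (List Bool × List Bool) → Prop} (hW : REPred W) :
    REPred fun x : (ℕ × ℕ) × List Bool => IsHeavyPrefix P W x.1.1 x.1.2 x.2 := by
  let T := ((ℕ × ℕ) × List Bool) × (List (List Bool) × ℕ)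
  have h1 : REPred fun x : T => x.2.1.Nodup :=
    (primrecPred_nodup.comp (Primrec.fst.comp Primrec.snd)).rePred
  have h2 : REPred fun x : T => ∀ v ∈ x.2.1, ∃ w : List Bool × List Bool,
      W (x.1.1.1, w) ∧ w.1 <+: x.1.2 ∧ w.2 <+: v ∧ v.length = x.2.2 := by
    have h3 : REPred fun y : (List Bool × T) × (List Bool × List Bool) =>
        W (y.1.2.1.1.1, y.2) ∧
          (y.2.1 <+: y.1.2.1.2 ∧ y.2.2 <+: y.1.1 ∧ y.1.1.length = y.1.2.2.2) := by
      have hx : Primrec fun y : (List Bool × T) × (List Bool × List Bool) => y.1.2 :=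
        Primrec.snd.comp Primrec.fst
      have hv : Primrec fun y : (List Bool × T) × (List Bool × List Bool) => y.1.1 :=
        Primrec.fst.comp Primrec.fst
      refine REPred.and ?_ (PrimrecPred.rePred (PrimrecPred.and ?_ (PrimrecPred.and ?_ ?_)))
      · exact hW.comp (Primrec.pair (Primrec.fst.comp (Primrec.fst.comp (Primrec.fst.comp hx)))
          Primrec.snd).to_comp
      · exact primrecRel_isPrefix.comp (Primrec.fst.comp Primrec.snd)
          (Primrec.snd.comp (Primrec.fst.comp hx))
      · exact primrecRel_isPrefix.comp (Primrec.snd.comp Primrec.snd) hv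
      · exact Primrec.eq.comp (Primrec.list_length.comp hv)
          (Primrec.snd.comp (Primrec.snd.comp hx))
    exact h3.exists.forall_mem_list.comp (f := fun x : T => (x.2.1, x))
      (Computable.pair (Computable.fst.comp Computable.snd) Computable.id)
  have h4 : REPred fun x : T =>
      P.real (rect (x.1.2, [])) < 2 ^ x.1.1.2 *
        (x.2.1.map fun v => P.real (rect (x.1.2, v))).sum := by
    have ha : Primrec fun x : T => x.1.2 := Primrec.snd.comp Primrec.fst
    have hl : Computable fun x : T => ([(x.1.2, [])] : List (List Bool × List Bool)) :=
      (Primrec.list_cons.comp (Primrec.pair ha (Primrec.const [])) (Primrec.const [])).to_comp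
    have hD : Primrec fun x : T => x.2.1 := Primrec.fst.comp Primrec.snd
    have hp : Primrec₂ fun (x : T) (v : List Bool) => (x.1.2, v) :=
      Primrec.pair (ha.comp Primrec.fst) Primrec.snd
    have hm : Computable fun x : T => x.2.1.map fun v => (x.1.2, v) :=
      (Primrec.list_map hD hp).to_comp
    have hk : Computable fun x : T => x.1.1.2 :=
      Computable.snd.comp (Computable.fst.comp Computable.fst)
    have h2k : Computable fun x : T => 2 ^ x.1.1.2 := computable_two_pow.comp hk
    have hf := (hl.pair (Computable.const 1)).pair (hm.pair h2k)
    refine (hP.rePred_sum_lt_sum.comp hf).of_eq fun x => ?_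
    simp [Function.comp_def]
  exact (h1.and (h2.and h4)).exists

theorem pairwiseDisjoint_cyl {D : Set (List Bool)} {N : ℕ}
    (hD : ∀ v ∈ D, v.length = N) : D.PairwiseDisjoint cyl := by
  intro v hv w hw hne
  refine Set.disjoint_left.2 fun β h1 h2 => hne ?_
  rw [← mem_cyl.1 h1, ← mem_cyl.1 h2, hD v hv, hD w hw]

/-- The witnessing strings have equal length and are distinct, so their rectangles over `[a]` are
disjoint; all of them lie in the open set. -/
theorem IsHeavyPrefix.real_le [IsFiniteMeasure P] {W : ℕ × (List Bool × List Bool) → Prop}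
    {k m : ℕ} {a : List Bool} (h : IsHeavyPrefix P W k m a) :
    P.fst.real (cyl a) ≤
      2 ^ m * (P.restrict (⋃ w ∈ {w | W (k, w)}, rect w)).fst.real (cyl a) := by
  obtain ⟨⟨D, N⟩, hD, hDW, hlt⟩ := h
  dsimp only at hD hDW hlt
  rw [measureReal_def, fst_cyl, ← measureReal_def]
  refine hlt.le.trans ?_
  gcongr
  have hlen : ∀ v ∈ (D.toFinset : Set (List Bool)), v.length = N := fun v hv => by
    obtain ⟨w, -, -, -, h⟩ := hDW v (by simpa using hv)
    exact h
  have hdisj : (D.toFinset : Set (List Bool)).PairwiseDisjoint fun v => rect (a, v) := by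
    intro v hv w hw hne
    exact Set.Disjoint.set_prod_right (pairwiseDisjoint_cyl hlen hv hw hne) _ _
  rw [← List.sum_toFinset _ hD,
    ← measureReal_biUnion_finset hdisj fun v _ => measurableSet_rect _,
    measureReal_def, measureReal_def, fst_restrict_cyl]
  refine ENNReal.toReal_mono (measure_ne_top _ _) (measure_mono ?_)
  refine Set.iUnion₂_subset fun v hv => Set.subset_inter ?_ ?_
  · exact Set.prod_mono_right (Set.subset_univ _)
  · obtain ⟨w, hw, h1, h2, -⟩ := hDW v (by simpa using hv)
    exact (Set.prod_mono (cyl_subset_cyl h1) (cyl_subset_cyl h2)).trans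
      (Set.subset_biUnion_of_mem (u := rect) (show w ∈ {w | W (k, w)} from hw))

theorem IsMLRandom.exists_not_isHeavyPrefix [IsFiniteMeasure P] (hP : IsComputableMeasure P)
    {α : Cantor} (hα : IsMLRandom cyl P.fst α) {W : ℕ × (List Bool × List Bool) → Prop}
    (hW : REPred W) (hWP : ∀ n, P (⋃ w ∈ {w | W (n, w)}, rect w) ≤ (2 ^ n)⁻¹) (m₀ : ℕ) :
    ∃ m ≥ m₀, ∀ n, ¬ IsHeavyPrefix P W (2 * m) m (initSeg α n) := by
  -- Index `2m` pays for the factor `2^m` lost in the Markov-type bound and leaves `2^(-m) ≤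
  -- 2^(-j)`; the shift by `m₀` makes `m` as large as required.
  let V : ℕ → Set Cantor := fun j =>
    ⋃ a ∈ {a | IsHeavyPrefix P W (2 * (m₀ + j)) (m₀ + j) a}, cyl a
  have htest : IsMLTest cyl P.fst V := by
    refine ⟨⟨fun x => IsHeavyPrefix P W (2 * (m₀ + x.1)) (m₀ + x.1) x.2, ?_, fun n => rfl⟩,
      fun j => ?_⟩
    · have h : Primrec fun x : ℕ × List Bool => m₀ + x.1 :=
        Primrec.nat_add.comp (Primrec.const _) Primrec.fst
      exact (hP.rePred_isHeavyPrefix hW).comp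
        (f := fun x : ℕ × List Bool => ((2 * (m₀ + x.1), m₀ + x.1), x.2))
        (Primrec.pair (Primrec.pair (Primrec.nat_double.comp h) h) Primrec.snd).to_comp
    · set m := m₀ + j
      set U := ⋃ w ∈ {w | W (2 * m, w)}, rect w
      have h1 : 1 * P.fst.real (V j) ≤ 2 ^ m * (P.restrict U).fst.real (V j) :=
        mul_measureReal_iUnion_cyl_le zero_le_one (by positivity) fun a ha => by
          rw [one_mul]; exact IsHeavyPrefix.real_le ha
      have h2 : (P.restrict U).fst.real (V j) ≤ (2 ^ (2 * m))⁻¹ := by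
        have h3 : (P.restrict U).fst (V j) ≤ (2 ^ (2 * m))⁻¹ := by
          refine (measure_mono (Set.subset_univ _)).trans ?_
          rw [Measure.fst_univ, Measure.restrict_apply_univ]
          exact hWP _
        have h4 := ENNReal.toReal_mono (by simp) h3
        simpa [measureReal_def] using h4
      have h5 : P.fst.real (V j) ≤ (2 ^ j)⁻¹ := by
        calc P.fst.real (V j) ≤ 2 ^ m * (2 ^ (2 * m))⁻¹ := by
              rw [← one_mul (P.fst.real _)]
              exact h1.trans (mul_le_mul_of_nonneg_left h2 (by positivity))
          _ = (2 ^ m)⁻¹ := by rw [two_mul, pow_add _ m m, mul_inv, mul_inv_cancel_left₀ (by positivity)]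
          _ ≤ (2 ^ j)⁻¹ := by
              gcongr
              · norm_num
              · exact Nat.le_add_left _ _
      rw [← ofReal_measureReal (μ := P.fst) (s := V j) (measure_ne_top _ _)]
      refine (ENNReal.ofReal_le_ofReal h5).trans_eq ?_
      rw [ENNReal.ofReal_inv_of_pos (by positivity), ENNReal.ofReal_pow (by norm_num)]
      simp
  have := hα V htest
  simp only [Set.mem_iInter, not_forall] at this
  obtain ⟨j, hj⟩ := this
  exact ⟨m₀ + j, Nat.le_add_right _ _, fun n hn =>
    hj (Set.mem_biUnion (show _ ∈ {a | _} from hn) (mem_cyl_initSeg α n))⟩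

/-- The section is exhausted by clopen sets, each a finite union of cylinders of one length. On
these, `Q` is a limit of ratios that non-heaviness keeps at most `2^(-m)`. -/
theorem IsConditionalMeasure.section_le [IsFiniteMeasure P] {α : Cantor} {Q : Measure Cantor}
    (hQ : IsConditionalMeasure P α Q) {W : ℕ × (List Bool × List Bool) → Prop} {k m : ℕ}
    (h : ∀ n, ¬ IsHeavyPrefix P W k m (initSeg α n)) :
    Q (Prod.mk α ⁻¹' ⋃ w ∈ {w | W (k, w)}, rect w) ≤ (2 ^ m)⁻¹ := by
  -- Bounding the first component by `initSeg α N` too ensures that all later prefixes of `α` extend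
  -- it.
  let E : ℕ → Set (List Bool) := fun N =>
    {v | v.length = N ∧ ∃ w, W (k, w) ∧ w.1 <+: initSeg α N ∧ w.2 <+: v}
  have hE : ∀ N, (E N).Finite := fun N =>
    (List.finite_length_eq Bool N).subset fun v hv => hv.1
  let C : ℕ → Set Cantor := fun N => ⋃ v ∈ E N, cyl v
  have hmem : ∀ N β, β ∈ C N ↔
      ∃ w, W (k, w) ∧ w.1 <+: initSeg α N ∧ w.2 <+: initSeg β N := by
    intro N β
    simp only [C, Set.mem_iUnion, exists_prop]
    constructor
    · rintro ⟨v, ⟨hv, w, hw, h1, h2⟩, hβ⟩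
      rw [mem_cyl, hv] at hβ
      exact ⟨w, hw, h1, hβ ▸ h2⟩
    · rintro ⟨w, hw, h1, h2⟩
      exact ⟨initSeg β N, ⟨length_initSeg _ _, w, hw, h1, h2⟩, mem_cyl_initSeg _ _⟩
  have hmono : Monotone C := by
    intro M N hMN β hβ
    obtain ⟨w, hw, h1, h2⟩ := (hmem _ _).1 hβ
    exact (hmem _ _).2 ⟨w, hw, h1.trans (initSeg_prefix_initSeg α hMN),
      h2.trans (initSeg_prefix_initSeg β hMN)⟩
  have hsub : (Prod.mk α ⁻¹' ⋃ w ∈ {w | W (k, w)}, rect w) ⊆ ⋃ N, C N := by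
    intro β hβ
    simp only [Set.mem_preimage, Set.mem_iUnion, exists_prop] at hβ
    obtain ⟨w, hw, h1, h2⟩ := hβ
    exact Set.mem_iUnion.2 ⟨max w.1.length w.2.length, (hmem _ _).2
      ⟨w, hw, prefix_initSeg_iff.2 ⟨le_max_left _ _, h1⟩,
        prefix_initSeg_iff.2 ⟨le_max_right _ _, h2⟩⟩⟩
  refine (measure_mono hsub).trans ?_
  rw [hmono.measure_iUnion]
  refine iSup_le fun N => ?_
  let D : Finset (List Bool) := (hE N).toFinset
  have hCD : C N = ⋃ v ∈ D, cyl v := by simp [C, D]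
  have hdisj : (D : Set (List Bool)).PairwiseDisjoint cyl :=
    pairwiseDisjoint_cyl (N := N) fun v hv => by
      have : v ∈ E N := by simpa [D] using hv
      exact this.1
  rw [hCD, measure_biUnion_finset hdisj fun v _ => measurableSet_cyl v]
  refine le_of_tendsto (tendsto_finsetSum D fun v _ => hQ.2 v) ?_
  filter_upwards [eventually_ge_atTop N] with n hn
  have h1 : 2 ^ m * (D.toList.map fun v => P.real (rect (initSeg α n, v))).sum ≤
      P.real (rect (initSeg α n, [])) := by
    by_contra hlt
    -- Were the bound to fail, `D` itself would witness that this prefix is heavy.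
    refine h n ⟨(D.toList, N), D.nodup_toList, fun v hv => ?_, not_le.1 hlt⟩
    have : v ∈ E N := by simpa [D] using hv
    obtain ⟨hl, w, hw, hw1, hw2⟩ := this
    exact ⟨w, hw, hw1.trans (initSeg_prefix_initSeg α hn), hw2, hl⟩
  rw [Finset.sum_map_toList] at h1
  have h2 : 2 ^ m * ∑ v ∈ D, P (rect (initSeg α n, v)) ≤ P.fst (cyl (initSeg α n)) := by
    have h3 := ENNReal.ofReal_le_ofReal h1
    rw [ENNReal.ofReal_mul (by positivity), ENNReal.ofReal_pow (by norm_num),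
      ENNReal.ofReal_sum_of_nonneg fun _ _ => measureReal_nonneg, ofReal_measureReal,
      ← fst_cyl] at h3
    simpa using h3
  simp only [div_eq_mul_inv]
  rw [← Finset.sum_mul, ← div_eq_mul_inv]
  refine ENNReal.div_le_of_le_mul ?_
  rw [mul_comm, ← div_eq_mul_inv, ENNReal.le_div_iff_mul_le (by simp) (by simp), mul_comm]
  exact h2

theorem IsConditionalMeasure.measure_section_iInter_eq_zero [IsFiniteMeasure P]
    (hP : IsComputableMeasure P) {α : Cantor} (hα : IsMLRandom cyl P.fst α) {Q : Measure Cantor}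
    (hQ : IsConditionalMeasure P α Q) {U : ℕ → Set (Cantor × Cantor)} (hU : IsMLTest rect P U) :
    Q (Prod.mk α ⁻¹' ⋂ n, U n) = 0 := by
  obtain ⟨⟨W, hW, hUW⟩, hUP⟩ := hU
  have h : ∀ m₀ : ℕ, Q (Prod.mk α ⁻¹' ⋂ n, U n) ≤ 2⁻¹ ^ m₀ := by
    intro m₀
    obtain ⟨m, hm, hm'⟩ := hα.exists_not_isHeavyPrefix hP hW (fun n => hUW n ▸ hUP n) m₀
    calc Q (Prod.mk α ⁻¹' ⋂ n, U n) ≤ Q (Prod.mk α ⁻¹' U (2 * m)) :=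
          measure_mono (Set.preimage_mono (Set.iInter_subset _ _))
      _ ≤ (2 ^ m)⁻¹ := by rw [hUW]; exact hQ.section_le hm'
      _ = 2⁻¹ ^ m := ENNReal.inv_pow
      _ ≤ 2⁻¹ ^ m₀ := pow_le_pow_right_of_le_one' (by simp) hm
  have hlim := ENNReal.tendsto_pow_atTop_nhds_zero_of_lt_one (r := 2⁻¹) (by simp)
  exact le_antisymm (ge_of_tendsto' hlim h) zero_le

/-- A test is determined by the enumerable set of its indices, and there are only countably many
programs. -/
theorem countable_setOf_isMLTest {ι X : Type*} [Primcodable ι] [MeasurableSpace X]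
    (B : ι → Set X) (μ : Measure X) : {U | IsMLTest B μ U}.Countable := by
  refine ((countable_setOf_rePred (α := ℕ × ι)).image
    fun W n => ⋃ i ∈ {i | W (n, i)}, B i).mono ?_
  rintro U ⟨⟨W, hW, hUW⟩, -⟩
  exact ⟨W, hW, (funext hUW).symm⟩

end Sections

/-! ### The main theorem -/

theorem mainTheorem2 (P : Measure (Cantor × Cantor)) [IsProbabilityMeasure P]
    (hP : IsComputableMeasure P) (α₁ : Cantor) (hα₁ : IsMLRandom cyl P.fst α₁) :
    (∃! Q : Measure Cantor, IsConditionalMeasure P α₁ Q) ∧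
      ∀ Q : Measure Cantor, IsConditionalMeasure P α₁ Q →
        IsProbabilityMeasure Q ∧
          MeasurableSet {α₂ : Cantor | IsMLRandom rect P (α₁, α₂)} ∧
          Q {α₂ : Cantor | IsMLRandom rect P (α₁, α₂)} = 1 := by
  refine ⟨?_, fun Q hQ => ?_⟩
  · obtain ⟨Q, hQ⟩ := exists_isConditionalMeasure hα₁.fst_cyl_ne_zero (hα₁.exists_tendsto hP)
    exact ⟨Q, hQ, fun Q' hQ' => hQ'.unique hQ⟩
  · have := hQ.isProbabilityMeasure
    have hcount := countable_setOf_isMLTest rect P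
    -- The nonrandom pairs over `α₁` form a countable union of sections of tests, which yields both
    -- measurability and measure zero.
    have hcompl : {α₂ : Cantor | IsMLRandom rect P (α₁, α₂)}ᶜ =
        ⋃ U ∈ {U | IsMLTest rect P U}, Prod.mk α₁ ⁻¹' ⋂ n, U n := by
      ext α₂
      simp [IsMLRandom]
    have hmeas : MeasurableSet {α₂ : Cantor | IsMLRandom rect P (α₁, α₂)} := by
      rw [← MeasurableSet.compl_iff, hcompl]
      refine MeasurableSet.biUnion hcount ?_
      rintro U ⟨⟨W, -, hUW⟩, -⟩
      have hU : MeasurableSet (⋂ n, U n) := MeasurableSet.iInter fun n => by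
        rw [hUW]
        exact MeasurableSet.biUnion (Set.to_countable _) fun w _ => measurableSet_rect w
      exact measurable_prodMk_left hU
    refine ⟨this, hmeas, ?_⟩
    rw [← prob_compl_eq_zero_iff hmeas, hcompl, measure_biUnion_null_iff hcount]
    exact fun U hU => hQ.measure_section_iInter_eq_zero hP hα₁ hU
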